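/- For a partition $\nu=(\nu_1\ge\nu_2\ge\cdots)$ with conjugate $\nu^*$, let $h(\nu)=\prod_{(i,j)\in\nu}(\nu_i+\nu^*_j-i-j+1)$ be the product of the hook-lengths of the boxes $(i,j)$ of its Young diagram (so $h(\emptyset)=1$). For partitions $\lambda,\mu,\nu$ let $c_{\lambda,\mu}^{\nu}$ be the Littlewood-Richardson coefficient, that is, the coefficient of the Schur function $s_\nu$ in the expansion $s_\lambda s_\mu=\sum_\nu c_{\lambda,\mu}^\nu s_\nu$ of a product of Schur functions in the basis of Schur functions. Then for any two partitions $\lambda,\mu$ only finitely many $c_{\lambda,\mu}^\nu$ are non-zero, and $$\sum_\nu \frac{h(\lambda)h(\mu)}{h(\nu)}\,c_{\lambda,\mu}^\nu=1,$$ where the sum is over all partitions $\nu$. -/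

import Mathlib

open scoped BigOperators

/-! ## Partitions and hook lengths

Partitions are identified with their Young diagrams (`YoungDiagram`): the boxes are the pairs
`(i, j)`, `i` the row and `j` the column, both counted from `0`. -/

/-- The length of the hook of the box `(i, j)` of `ν`: with rows and columns counted from `0` it is
`(ν_i - j) + (ν*_j - i) - 1`. No subtraction is truncated when the box lies in `ν`. -/
def hookLength (ν : YoungDiagram) (c : ℕ × ℕ) : ℕ :=
  (ν.rowLen c.1 - c.2) + (ν.colLen c.2 - c.1) - 1

/-- `h(ν)`: the product of the hook lengths of the boxes of `ν`. -/
def hookProd (ν : YoungDiagram) : ℕ :=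
  ∏ c ∈ ν.cells, hookLength ν c

/-! ## Schur functions

The ring of symmetric functions is the polynomial ring `ℤ[c₁, c₂, …]` in the elementary symmetric
functions (universal Chern classes), here `MvPolynomial ℕ ℤ` with `X k` standing for `c_{k+1}`. -/

/-- The `k`-th elementary symmetric function (universal Chern class) `c_k`, with `c_0 = 1` and
`c_k = 0` for `k < 0`. -/
noncomputable def chernClass : ℤ → MvPolynomial ℕ ℤ
  | .ofNat 0 => 1
  | .ofNat (k + 1) => MvPolynomial.X k
  | .negSucc _ => 0

/-- The Schur function `s_μ = det (c_{μ*_i - i + j})`, a determinant of size `μ_1`. -/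
noncomputable def schur (μ : YoungDiagram) : MvPolynomial ℕ ℤ :=
  Matrix.det (Matrix.of fun i j : Fin (μ.rowLen 0) =>
    chernClass ((μ.colLen i : ℤ) - (i : ℤ) + (j : ℤ)))

/-! ## The Schur functions form an additive basis -/

namespace SchurBasis

theorem triangular {ι M : Type*} [AddCommGroup M] (B : Module.Basis ι ℤ M) (v : ι → M)
    (r : ι → ℕ) (h1 : ∀ i, B.repr (v i) i = 1)
    (h2 : ∀ i j, B.repr (v i) j ≠ 0 → j = i ∨ r j < r i) :
    LinearIndependent ℤ v ∧ ⊤ ≤ Submodule.span ℤ (Set.range v) := by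
  classical
  constructor
  · rw [linearIndependent_iff]
    intro l hl
    by_contra hne
    obtain ⟨i, hi, hmax⟩ := l.support.exists_max_image r (Finsupp.support_nonempty_iff.2 hne)
    have h : B.repr (Finsupp.linearCombination ℤ v l) i = l i := by
      rw [Finsupp.linearCombination_apply, Finsupp.sum, map_sum, Finsupp.finsetSum_apply,
        Finset.sum_eq_single i]
      · simp [h1]
      · intro b hb hbi
        by_cases h0 : B.repr (v b) i = 0
        · simp [h0]
        · rcases h2 b i h0 with h | h
          · exact absurd h.symm hbi
          · exact absurd (hmax b hb) (not_le.2 h)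
      · intro h
        exact absurd hi h
    rw [hl] at h
    exact (Finsupp.mem_support_iff.1 hi) (by simpa using h.symm)
  · have key : ∀ n i, r i = n → B i ∈ Submodule.span ℤ (Set.range v) := by
      intro n
      induction n using Nat.strong_induction_on with
      | _ n ih =>
        intro i hi
        have hm : i ∈ (B.repr (v i)).support := by simp [h1]
        have hs := (Finset.add_sum_erase _ (fun j => B.repr (v i) j • B j) hm).trans
          (B.linearCombination_repr (v i))
        rw [h1, one_smul] at hs
        have hB : B i = v i - ∑ j ∈ (B.repr (v i)).support.erase i, B.repr (v i) j • B j :=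
          eq_sub_of_add_eq hs
        rw [hB]
        refine Submodule.sub_mem _ (Submodule.subset_span ⟨i, rfl⟩) (Submodule.sum_mem _ ?_)
        intro j hj
        rw [Finset.mem_erase, Finsupp.mem_support_iff] at hj
        rcases h2 i j hj.2 with h | h
        · exact absurd h hj.1
        · exact Submodule.smul_mem _ _ (ih (r j) (hi ▸ h) j rfl)
    rw [← B.span_eq, Submodule.span_le]
    rintro _ ⟨i, rfl⟩
    exact key _ i rfl

/-- The exponent of the monomial `c_k`. -/
noncomputable def expo : ℕ → (ℕ →₀ ℕ)
  | 0 => 0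
  | k + 1 => Finsupp.single k 1

theorem chernClass_natCast (k : ℕ) :
    chernClass (k : ℤ) = MvPolynomial.monomial (expo k) 1 := by
  cases k with
  | zero => exact (map_one MvPolynomial.C).symm
  | succ k => rfl

theorem chernClass_neg {k : ℤ} (hk : k < 0) : chernClass k = 0 := by
  cases k with
  | ofNat k => exact absurd hk (by simp)
  | negSucc k => rfl

/-- Degree of a monomial. -/
noncomputable def wt : (ℕ →₀ ℕ) →ₗ[ℕ] ℕ := Finsupp.linearCombination ℕ (fun k => k + 1)

/-- Sum of the squares of the parts of a monomial. -/
noncomputable def sq : (ℕ →₀ ℕ) →ₗ[ℕ] ℕ := Finsupp.linearCombination ℕ (fun k => (k + 1) ^ 2)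

theorem wt_expo (k : ℕ) : wt (expo k) = k := by
  cases k <;> simp [wt, expo]

theorem sq_expo (k : ℕ) : sq (expo k) = k ^ 2 := by
  cases k <;> simp [sq, expo]

theorem sq_le (m : ℕ →₀ ℕ) : sq m ≤ wt m ^ 2 := by
  induction m using Finsupp.induction_linear with
  | zero => simp
  | add f g hf hg =>
    rw [map_add, map_add]
    nlinarith [Nat.zero_le (wt f * wt g)]
  | single k n =>
    simp only [sq, wt, Finsupp.linearCombination_single, smul_eq_mul, mul_pow]
    exact Nat.mul_le_mul_right _ (Nat.le_self_pow two_ne_zero n)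

theorem prod_chernClass {n : ℕ} (f : Fin n → ℕ) :
    ∏ i, chernClass (f i : ℤ) = MvPolynomial.monomial (∑ i, expo (f i)) 1 := by
  simp [chernClass_natCast, MvPolynomial.monomial_sum_one]

/-- The exponent of the leading monomial `∏ c_{μ*_j}` of the Schur function `s_μ`. -/
noncomputable def lead (μ : YoungDiagram) : ℕ →₀ ℕ :=
  ∑ j : Fin (μ.rowLen 0), expo (μ.colLen j)

theorem colLen_pos (μ : YoungDiagram) (j : Fin (μ.rowLen 0)) : 0 < μ.colLen j := by
  rw [← YoungDiagram.mem_iff_lt_colLen, YoungDiagram.mem_iff_lt_rowLen]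
  exact j.2

theorem perm_eq_one {n : ℕ} (b : Fin n → ℤ) (hb : StrictAnti b) (σ : Equiv.Perm (Fin n))
    (h : Antitone (b ∘ σ)) : σ = 1 := by
  have hσ : Monotone σ := by
    intro i j hij
    exact hb.le_iff_ge.1 (h hij)
  have h2 := hσ.strictMono_of_injective σ.injective
  ext i
  have h3 : (h2.orderIsoOfSurjective _ σ.surjective) = OrderIso.refl _ := Subsingleton.elim _ _
  have h4 := congrArg (fun f => f i) h3
  simpa using congrArg Fin.val h4

theorem sum_sq_lt {n : ℕ} (b : Fin n → ℤ) (hb : StrictAnti b) (σ : Equiv.Perm (Fin n))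
    (hσ : σ ≠ 1) :
    ∑ i : Fin n, (b i + (i : ℤ)) ^ 2 < ∑ i : Fin n, (b (σ i) + (i : ℤ)) ^ 2 := by
  have hav : Antivary b (fun i : Fin n => (i : ℤ)) := by
    intro i j hij
    exact hb.antitone (by
      have : (i : ℤ) < j := hij
      exact Fin.le_def.2 (by omega))
  have h := (hav.sum_mul_lt_sum_comp_perm_mul_iff (σ := σ)).2 (by
    intro h
    refine hσ (perm_eq_one b hb σ ?_)
    intro i j hij
    rcases hij.eq_or_lt with rfl | hlt
    · exact le_rfl
    · exact h (by
        show (i : ℤ) < j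
        exact_mod_cast hlt))
  have h2 : ∑ i, b (σ i) ^ 2 = ∑ i, b i ^ 2 := Equiv.sum_comp σ (fun i => b i ^ 2)
  have e1 : ∑ i : Fin n, (b i + (i : ℤ)) ^ 2
      = ∑ i, b i ^ 2 + 2 * ∑ i : Fin n, b i * (i : ℤ) + ∑ i : Fin n, (i : ℤ) ^ 2 := by
    rw [Finset.mul_sum, ← Finset.sum_add_distrib, ← Finset.sum_add_distrib]
    exact Finset.sum_congr rfl fun i _ => by ring
  have e2 : ∑ i : Fin n, (b (σ i) + (i : ℤ)) ^ 2
      = ∑ i, b (σ i) ^ 2 + 2 * ∑ i : Fin n, b (σ i) * (i : ℤ) + ∑ i : Fin n, (i : ℤ) ^ 2 := by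
    rw [Finset.mul_sum, ← Finset.sum_add_distrib, ← Finset.sum_add_distrib]
    exact Finset.sum_congr rfl fun i _ => by ring
  rw [e1, e2, h2]
  linarith

/-- A term of the determinant other than the diagonal one only has monomials of the same degree
with a larger sum of squares. -/
theorem coeff_term (μ : YoungDiagram) (σ : Equiv.Perm (Fin (μ.rowLen 0))) (hσ : σ ≠ 1)
    (m : ℕ →₀ ℕ)
    (hm : (∏ i : Fin (μ.rowLen 0),
      chernClass ((μ.colLen (σ i) : ℤ) - (σ i : ℤ) + (i : ℤ))).coeff m ≠ 0) :
    wt m = wt (lead μ) ∧ sq (lead μ) < sq m := by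
  set b : Fin (μ.rowLen 0) → ℤ := fun i => (μ.colLen i : ℤ) - (i : ℤ) with hb
  have hbs : StrictAnti b := by
    intro i j hij
    have h1 := μ.colLen_anti i j (le_of_lt hij)
    have h2 : (i : ℕ) < j := hij
    simp only [hb]
    omega
  by_cases hneg : ∃ i, b (σ i) + (i : ℤ) < 0
  · obtain ⟨i, hi⟩ := hneg
    refine absurd ?_ hm
    rw [Finset.prod_eq_zero (Finset.mem_univ i) (chernClass_neg hi), MvPolynomial.coeff_zero]
  · push Not at hneg
    choose f hf using fun i => Int.eq_ofNat_of_zero_le (hneg i)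
    have hp : ∏ i : Fin (μ.rowLen 0), chernClass ((μ.colLen (σ i) : ℤ) - (σ i : ℤ) + (i : ℤ))
        = MvPolynomial.monomial (∑ i, expo (f i)) 1 := by
      rw [← prod_chernClass]
      exact Finset.prod_congr rfl fun i _ => congrArg chernClass (hf i)
    rw [hp, MvPolynomial.coeff_monomial] at hm
    have hm' : ∑ i, expo (f i) = m := by
      by_contra h
      exact hm (if_neg h)
    subst hm'
    have hsb : ∑ i, b (σ i) = ∑ i, b i := Equiv.sum_comp σ b
    constructor
    · rw [lead, map_sum, map_sum]
      simp only [wt_expo]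
      zify
      simp only [← hf, Finset.sum_add_distrib, hsb]
      rw [← Finset.sum_add_distrib]
      exact Finset.sum_congr rfl fun i _ => by simp [hb]
    · rw [lead, map_sum, map_sum]
      simp only [sq_expo]
      zify
      have := sum_sq_lt b hbs σ hσ
      simp only [hf] at this
      refine lt_of_eq_of_lt (Finset.sum_congr rfl fun i _ => ?_) this
      simp [hb]

theorem schur_eq (μ : YoungDiagram) :
    schur μ = MvPolynomial.monomial (lead μ) 1 +
      ∑ σ ∈ (Finset.univ : Finset (Equiv.Perm (Fin (μ.rowLen 0)))).erase 1,
        (Equiv.Perm.sign σ : ℤ) •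
          ∏ i : Fin (μ.rowLen 0), chernClass ((μ.colLen (σ i) : ℤ) - (σ i : ℤ) + (i : ℤ)) := by
  rw [schur, Matrix.det_apply, ← Finset.add_sum_erase _ _ (Finset.mem_univ 1)]
  congr 1
  simp [lead, ← prod_chernClass]

theorem coeff_rest (μ : YoungDiagram) (m : ℕ →₀ ℕ)
    (hm : (∑ σ ∈ (Finset.univ : Finset (Equiv.Perm (Fin (μ.rowLen 0)))).erase 1,
        (Equiv.Perm.sign σ : ℤ) • ∏ i : Fin (μ.rowLen 0),
          chernClass ((μ.colLen (σ i) : ℤ) - (σ i : ℤ) + (i : ℤ))).coeff m ≠ 0) :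
    wt m = wt (lead μ) ∧ sq (lead μ) < sq m := by
  rw [MvPolynomial.coeff_sum] at hm
  obtain ⟨σ, hσ, h⟩ := Finset.exists_ne_zero_of_sum_ne_zero hm
  refine coeff_term μ σ (Finset.ne_of_mem_erase hσ) m ?_
  intro h0
  rw [MvPolynomial.coeff_smul, h0, smul_zero] at h
  exact h rfl

theorem coeff_schur_lead (μ : YoungDiagram) : (schur μ).coeff (lead μ) = 1 := by
  rw [schur_eq, MvPolynomial.coeff_add, MvPolynomial.coeff_monomial, if_pos rfl]
  by_contra h
  exact lt_irrefl _ (coeff_rest μ (lead μ) (fun h0 => h (by rw [h0, add_zero]))).2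

theorem coeff_schur (μ : YoungDiagram) (m : ℕ →₀ ℕ) (hm : (schur μ).coeff m ≠ 0) :
    m = lead μ ∨ wt m ^ 2 - sq m < wt (lead μ) ^ 2 - sq (lead μ) := by
  by_cases h : lead μ = m
  · exact Or.inl h.symm
  · right
    rw [schur_eq, MvPolynomial.coeff_add, MvPolynomial.coeff_monomial, if_neg h, zero_add] at hm
    obtain ⟨h1, h2⟩ := coeff_rest μ m hm
    have h3 := sq_le m
    rw [h1] at h3 ⊢
    omega

theorem toMultiset_expo {k : ℕ} (hk : 0 < k) :
    Finsupp.toMultiset (expo k) = {k - 1} := by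
  cases k with
  | zero => omega
  | succ k => simp [expo]

theorem sum_singleton (n : ℕ) (g : ℕ → ℕ) :
    ∑ x : Fin n, ({g x} : Multiset ℕ) = ((List.range n).map g : List ℕ) := by
  induction n with
  | zero => simp
  | succ n ih => simp [Fin.sum_univ_castSucc, ih, List.range_succ, ← Multiset.coe_add]

theorem toMultiset_lead (μ : YoungDiagram) :
    Finsupp.toMultiset (lead μ) = ((μ.transpose.rowLens.map (· - 1) : List ℕ) : Multiset ℕ) := by
  rw [lead, map_sum]
  simp only [toMultiset_expo (colLen_pos μ _)]
  rw [sum_singleton _ (fun j => μ.colLen j - 1)]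
  simp [YoungDiagram.rowLens, Function.comp_def]

theorem map_pred_succ (l : List ℕ) (h : ∀ x ∈ l, 0 < x) :
    (l.map (· - 1)).map (· + 1) = l := by
  rw [List.map_map]
  conv_rhs => rw [← List.map_id l]
  refine List.map_congr_left fun x hx => ?_
  have := h x hx
  simp only [Function.comp_apply, id_eq]
  omega

theorem lead_bijective : Function.Bijective lead := by
  constructor
  · intro μ ν h
    have h1 := congrArg Finsupp.toMultiset h
    rw [toMultiset_lead, toMultiset_lead, Multiset.coe_eq_coe] at h1
    have h2 := h1.map (· + 1)
    rw [map_pred_succ _ (YoungDiagram.pos_of_mem_rowLens _),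
      map_pred_succ _ (YoungDiagram.pos_of_mem_rowLens _)] at h2
    have h3 := h2.eq_of_sortedGE (YoungDiagram.rowLens_sorted _) (YoungDiagram.rowLens_sorted _)
    exact YoungDiagram.transpose_eq_iff.1
      (YoungDiagram.equivListRowLens.injective (Subtype.ext h3))
  · intro m
    set l : List ℕ := ((Finsupp.toMultiset m).map (· + 1)).sort (· ≥ ·) with hl
    have hs : l.SortedGE := (Multiset.pairwise_sort _ _).sortedGE
    have hp : ∀ x ∈ l, 0 < x := by
      intro x hx
      rw [hl, Multiset.mem_sort, Multiset.mem_map] at hx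
      obtain ⟨y, _, rfl⟩ := hx
      exact Nat.succ_pos y
    refine ⟨(YoungDiagram.ofRowLens l hs).transpose, (Multiset.toFinsupp.symm.injective ?_)⟩
    change Finsupp.toMultiset _ = Finsupp.toMultiset m
    rw [toMultiset_lead, YoungDiagram.transpose_transpose,
      YoungDiagram.rowLens_ofRowLens_eq_self hp, ← Multiset.map_coe, hl, Multiset.sort_eq,
      Multiset.map_map]
    simp

theorem isBasis : LinearIndependent ℤ schur ∧ ⊤ ≤ Submodule.span ℤ (Set.range schur) := by
  let e := Equiv.ofBijective lead lead_bijective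
  let B := (MvPolynomial.basisMonomials ℕ ℤ).reindex e.symm
  have hB : ∀ p μ, B.repr p μ = p.coeff (lead μ) := by
    intro p μ
    rw [Module.Basis.repr_reindex_apply]
    rfl
  refine triangular B schur (fun μ => wt (lead μ) ^ 2 - sq (lead μ)) ?_ ?_
  · intro μ
    rw [hB, coeff_schur_lead]
  · intro μ ν h
    rw [hB] at h
    rcases coeff_schur μ _ h with h | h
    · exact Or.inl (lead_bijective.1 h)
    · exact Or.inr h

end SchurBasis

/-- The basis `(s_μ)` of the ring of symmetric functions, indexed by all partitions. -/
noncomputable def schurBasis : Module.Basis YoungDiagram ℤ (MvPolynomial ℕ ℤ) :=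
  Module.Basis.mk SchurBasis.isBasis.1 SchurBasis.isBasis.2

theorem schurBasis_apply (μ : YoungDiagram) : schurBasis μ = schur μ :=
  Module.Basis.mk_apply _ _ μ

/-- The Littlewood-Richardson coefficient `c^ν_{lam,μ}`: the coefficient of `s_ν` in the expansion
of the product `s_lam s_μ` in the basis of Schur functions. -/
noncomputable def lrCoeff (lam μ ν : YoungDiagram) : ℤ :=
  schurBasis.repr (schur lam * schur μ) ν

/-! The specialization `c_k ↦ 1 / k!` is a ring homomorphism to `ℚ`, and it sends `s_ν` to `1 /
h(ν)` (`expSpecialization_schur`). Applied to `s_λ s_μ = ∑ c^ν_{λμ} s_ν`, a finite sum because it is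
an expansion in a basis, it gives `1 / (h(λ) h(μ)) = ∑ c^ν_{λμ} / h(ν)`, which is the claim.

The value at `s_ν` is computed twice from the shifted column lengths `l_j`. The specialized
determinant reduces to a Vandermonde determinant, with value `∏_{i<j} (l_j - l_i) / ∏ l_j!`.
Combinatorially, in each column the hook lengths together with the differences `l_j - l_i`, `i < j`,
exhaust `1, …, l_j` (`prod_hookLength_col_mul`), so the same quotient equals `1 / h(ν)`. -/

/-! ## The hook length formula

The column lengths of `μ`, read from right to left and made strictly increasing by a staircase, are
the numbers `shiftedColLen μ j`. Both the product of the hook lengths and the exponential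
specialization of `s_μ` are expressed through them. -/

/-- The number `μ*_{m-1-j} + j`, where `m = μ_1`. -/
def shiftedColLen (μ : YoungDiagram) (j : Fin (μ.rowLen 0)) : ℕ :=
  μ.colLen j.rev + j

theorem shiftedColLen_strictMono (μ : YoungDiagram) : StrictMono (shiftedColLen μ) := by
  intro i j hij
  have h := μ.colLen_anti j.rev i.rev (Fin.rev_le_rev.2 hij.le)
  have h' : (i : ℕ) < j := hij
  simp only [shiftedColLen]
  omega

theorem hookLength_add (μ : YoungDiagram) {r c : ℕ} (h : (r, c) ∈ μ) :
    hookLength μ (r, c) + r + c + 1 = μ.rowLen r + μ.colLen c := by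
  have h1 := YoungDiagram.mem_iff_lt_rowLen.1 h
  have h2 := YoungDiagram.mem_iff_lt_colLen.1 h
  simp only [hookLength]
  omega

theorem hookLength_pos (μ : YoungDiagram) {c : ℕ × ℕ} (h : c ∈ μ) : 0 < hookLength μ c := by
  have h1 := YoungDiagram.mem_iff_lt_rowLen.1 h
  have h2 := YoungDiagram.mem_iff_lt_colLen.1 h
  simp only [hookLength]
  omega

theorem hookProd_pos (μ : YoungDiagram) : 0 < hookProd μ :=
  Finset.prod_pos fun _ hc => hookLength_pos μ ((μ.mem_cells _).1 hc)

/-- The hook lengths in a column are the numbers up to the shifted column length that are not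
differences with the shifted lengths of the columns to the right. -/
theorem prod_hookLength_col_mul (μ : YoungDiagram) (j : Fin (μ.rowLen 0)) :
    (∏ r ∈ Finset.range (μ.colLen j.rev), hookLength μ (r, j.rev)) *
      ∏ i ∈ Finset.Iio j, (shiftedColLen μ j - shiftedColLen μ i) =
    (shiftedColLen μ j).factorial := by
  have hmem : ∀ r ∈ Finset.range (μ.colLen j.rev), (r, (j.rev : ℕ)) ∈ μ := fun r hr =>
    YoungDiagram.mem_iff_lt_colLen.2 (Finset.mem_range.1 hr)
  have hrev : (j.rev : ℕ) + j + 1 = μ.rowLen 0 := by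
    rw [Fin.val_rev]
    omega
  have hlt : ∀ i ∈ Finset.Iio j, shiftedColLen μ i < shiftedColLen μ j := fun i hi =>
    shiftedColLen_strictMono μ (Finset.mem_Iio.1 hi)
  have hinj1 : Set.InjOn (fun r => hookLength μ (r, j.rev))
      (Finset.range (μ.colLen j.rev) : Set ℕ) := by
    intro r hr s hs h
    have h1 := hookLength_add μ (hmem r hr)
    have h2 := hookLength_add μ (hmem s hs)
    -- Down a column the hook lengths strictly decrease, since row lengths weakly decrease while `r`
    -- grows.
    simp only at h
    rcases le_total r s with hrs | hrs
    · have := μ.rowLen_anti r s hrs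
      omega
    · have := μ.rowLen_anti s r hrs
      omega
  have hinj2 : Set.InjOn (fun i => shiftedColLen μ j - shiftedColLen μ i)
      (Finset.Iio j : Set (Fin (μ.rowLen 0))) := by
    intro i hi k hk h
    have h1 := hlt i hi
    have h2 := hlt k hk
    simp only at h
    exact (shiftedColLen_strictMono μ).injective (by omega)
  have hdisj : Disjoint
      ((Finset.range (μ.colLen j.rev)).image fun r => hookLength μ (r, j.rev))
      ((Finset.Iio j).image fun i => shiftedColLen μ j - shiftedColLen μ i) := by
    rw [Finset.disjoint_left]
    intro x hx hx'
    obtain ⟨r, hr, rfl⟩ := Finset.mem_image.1 hx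
    obtain ⟨i, hi, h⟩ := Finset.mem_image.1 hx'
    have h1 := hookLength_add μ (hmem r hr)
    have h2 := hlt i hi
    have h3 : (i.rev : ℕ) + i + 1 = μ.rowLen 0 := by
      rw [Fin.val_rev]
      omega
    have h4 := YoungDiagram.mem_iff_lt_rowLen (μ := μ) (i := r) (j := i.rev)
    have h5 := YoungDiagram.mem_iff_lt_colLen (μ := μ) (i := r) (j := i.rev)
    simp only [shiftedColLen] at h h2
    -- With `c = i.rev`, equality would force `(μ_r - c) + (μ*_c - r) = 1`. Both summands are at
    -- least `1` if `(r, c)` lies in `μ`, and both are at most `0` otherwise.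
    by_cases hm : (r, (i.rev : ℕ)) ∈ μ
    · have := h4.1 hm
      have := h5.1 hm
      omega
    · have := mt h4.2 hm
      have := mt h5.2 hm
      omega
  have hunion : ((Finset.range (μ.colLen j.rev)).image fun r => hookLength μ (r, j.rev)) ∪
      ((Finset.Iio j).image fun i => shiftedColLen μ j - shiftedColLen μ i) =
      Finset.Ico 1 (shiftedColLen μ j + 1) := by
    -- The two disjoint sets have `μ*_{j.rev}` and `j` elements, as many in total as the interval
    -- that contains them.
    apply Finset.eq_of_subset_of_card_le
    · intro x hx
      rw [Finset.mem_Ico]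
      rcases Finset.mem_union.1 hx with hx | hx
      · obtain ⟨r, hr, rfl⟩ := Finset.mem_image.1 hx
        have h1 := hookLength_add μ (hmem r hr)
        have h2 := hookLength_pos μ (hmem r hr)
        have h3 := μ.rowLen_anti 0 r (Nat.zero_le r)
        simp only [shiftedColLen]
        omega
      · obtain ⟨i, hi, rfl⟩ := Finset.mem_image.1 hx
        have := hlt i hi
        omega
    · rw [Finset.card_union_of_disjoint hdisj, Finset.card_image_of_injOn hinj1,
        Finset.card_image_of_injOn hinj2]
      simp [shiftedColLen]
  rw [← Finset.prod_Ico_id_eq_factorial, ← hunion, Finset.prod_union hdisj,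
    Finset.prod_image hinj1, Finset.prod_image hinj2]

theorem hookProd_eq_prod_col (μ : YoungDiagram) :
    hookProd μ = ∏ j : Fin (μ.rowLen 0),
      ∏ r ∈ Finset.range (μ.colLen j.rev), hookLength μ (r, j.rev) := by
  have hrev := Equiv.prod_comp Fin.revPerm fun j : Fin (μ.rowLen 0) =>
    ∏ r ∈ Finset.range (μ.colLen j), hookLength μ (r, j)
  simp only [Fin.revPerm_apply] at hrev
  rw [hrev,
    Fin.prod_univ_eq_prod_range
      (fun j => ∏ r ∈ Finset.range (μ.colLen j), hookLength μ (r, j)) (μ.rowLen 0), hookProd]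
  refine Finset.prod_finset_product_right _ _ _ fun p => ?_
  rw [YoungDiagram.mem_cells, Finset.mem_range, Finset.mem_range, ← YoungDiagram.mem_iff_lt_colLen,
    ← YoungDiagram.mem_iff_lt_rowLen]
  exact ⟨fun h => ⟨μ.up_left_mem (Nat.zero_le _) le_rfl h, h⟩, fun h => h.2⟩

/-- Frobenius' form of the hook length formula. -/
theorem hookProd_mul_prod_sub (μ : YoungDiagram) :
    (hookProd μ : ℚ) * ∏ i, ∏ j ∈ Finset.Ioi i,
      ((shiftedColLen μ j : ℚ) - (shiftedColLen μ i : ℚ)) =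
    ∏ j, ((shiftedColLen μ j).factorial : ℚ) := by
  -- Grouping the pairs `i < j` by the larger index matches the column identity factor by factor.
  rw [Finset.prod_comm' (t' := Finset.univ) (s' := fun j => Finset.Iio j) (by simp),
    hookProd_eq_prod_col, Nat.cast_prod, ← Finset.prod_mul_distrib]
  refine Finset.prod_congr rfl fun j _ => ?_
  rw [← prod_hookLength_col_mul, Nat.cast_mul, Nat.cast_prod (s := Finset.Iio j)]
  congr 1
  refine Finset.prod_congr rfl fun i hi => ?_
  rw [Nat.cast_sub (shiftedColLen_strictMono μ (Finset.mem_Iio.1 hi)).le]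

/-! ## The exponential specialization -/

/-- The exponential specialization `c_k ↦ 1 / k!` of the ring of symmetric functions. -/
noncomputable def expSpecialization : MvPolynomial ℕ ℤ →+* ℚ :=
  MvPolynomial.eval₂Hom (Int.castRingHom ℚ) fun k => ((k + 1).factorial : ℚ)⁻¹

theorem expSpecialization_chernClass_natCast (k : ℕ) :
    expSpecialization (chernClass (k : ℤ)) = (k.factorial : ℚ)⁻¹ := by
  cases k with
  | zero =>
    change expSpecialization 1 = _
    simp
  | succ k => exact MvPolynomial.eval₂Hom_X' _ _ k

/-- Writing `1 / (x - k)!` as `x (x - 1) ⋯ (x - k + 1) / x!` splits a matrix entry into a row factor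
and a monic polynomial of degree `k` in `x`. For `k > x` both sides vanish, the falling factorial
having a zero factor. -/
theorem expSpecialization_chernClass_sub (x k : ℕ) :
    expSpecialization (chernClass ((x : ℤ) - (k : ℤ))) =
      (x.factorial : ℚ)⁻¹ * (descPochhammer ℚ k).eval (x : ℚ) := by
  rw [descPochhammer_eval_eq_descFactorial]
  rcases le_or_gt k x with h | h
  · rw [← Nat.cast_sub h, expSpecialization_chernClass_natCast, ← Nat.factorial_mul_descFactorial h,
      Nat.cast_mul]
    have h1 : ((x - k).factorial : ℚ) ≠ 0 := Nat.cast_ne_zero.2 (Nat.factorial_ne_zero _)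
    have h2 : (x.descFactorial k : ℚ) ≠ 0 :=
      Nat.cast_ne_zero.2 fun h0 => (Nat.descFactorial_eq_zero_iff_lt.1 h0).not_ge h
    field_simp
  · rw [SchurBasis.chernClass_neg (by omega), Nat.descFactorial_of_lt h, map_zero, Nat.cast_zero,
      mul_zero]

theorem expSpecialization_schur (μ : YoungDiagram) :
    expSpecialization (schur μ) = (hookProd μ : ℚ)⁻¹ := by
  have hdet : expSpecialization (schur μ) =
      (Matrix.of fun i j : Fin (μ.rowLen 0) => ((shiftedColLen μ i).factorial : ℚ)⁻¹ *
        (descPochhammer ℚ j).eval (shiftedColLen μ i : ℚ)).det := by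
    -- Reversing rows and columns together preserves the determinant and turns the index `μ*_i - i +
    -- j` into `l_i - j`.
    rw [schur, RingHom.map_det, ← Matrix.det_submatrix_equiv_self Fin.revPerm]
    congr 1
    ext i j
    rw [Matrix.of_apply, ← expSpecialization_chernClass_sub]
    have hi : (i.rev : ℕ) + i + 1 = μ.rowLen 0 := by
      rw [Fin.val_rev]
      omega
    have hj : (j.rev : ℕ) + j + 1 = μ.rowLen 0 := by
      rw [Fin.val_rev]
      omega
    refine congrArg (fun k => expSpecialization (chernClass k)) ?_
    simp only [shiftedColLen, Fin.revPerm_apply]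
    omega
  -- Falling factorials are monic of degrees `0, 1, 2, …`, so they may replace the powers in a
  -- Vandermonde determinant.
  have hvdm := Matrix.det_eval_matrixOfPolynomials_eq_det_vandermonde
    (fun i => (shiftedColLen μ i : ℚ)) (fun k => descPochhammer ℚ k)
    (fun k => descPochhammer_natDegree ℚ k) (fun k => monic_descPochhammer ℚ k)
  rw [Matrix.det_vandermonde] at hvdm
  rw [hdet]
  have hcol := Matrix.det_mul_column (fun i => ((shiftedColLen μ i).factorial : ℚ)⁻¹)
    (Matrix.of fun i j : Fin (μ.rowLen 0) =>
      (descPochhammer ℚ j).eval (shiftedColLen μ i : ℚ))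
  simp only [Matrix.of_apply] at hcol
  rw [hcol, ← hvdm, Finset.prod_inv_distrib, ← hookProd_mul_prod_sub]
  have h1 : (hookProd μ : ℚ) ≠ 0 := Nat.cast_ne_zero.2 (hookProd_pos μ).ne'
  have h2 : ∏ i, ∏ j ∈ Finset.Ioi i,
      ((shiftedColLen μ j : ℚ) - (shiftedColLen μ i : ℚ)) ≠ 0 := by
    refine Finset.prod_ne_zero_iff.2 fun i _ => Finset.prod_ne_zero_iff.2 fun j hj => ?_
    exact sub_ne_zero.2
      (Nat.cast_injective.ne (shiftedColLen_strictMono μ (Finset.mem_Ioi.1 hj)).ne')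
  field_simp

/-! ## The sum over the Littlewood-Richardson coefficients -/

theorem support_lrCoeff (lam μ : YoungDiagram) :
    Function.support (lrCoeff lam μ) = ↑(schurBasis.repr (schur lam * schur μ)).support :=
  Finsupp.fun_support_eq _

theorem sum_lrCoeff_smul_schur (lam μ : YoungDiagram) :
    ∑ ν ∈ (schurBasis.repr (schur lam * schur μ)).support, lrCoeff lam μ ν • schur ν =
      schur lam * schur μ := by
  conv_rhs => rw [← schurBasis.linearCombination_repr (schur lam * schur μ)]
  simp only [Finsupp.linearCombination_apply, Finsupp.sum, schurBasis_apply, lrCoeff]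

theorem corollary7 (lam μ : YoungDiagram) :
    (Function.support (lrCoeff lam μ)).Finite ∧
    ∑ᶠ ν : YoungDiagram,
      ((hookProd lam : ℚ) * (hookProd μ : ℚ) / (hookProd ν : ℚ)) * (lrCoeff lam μ ν : ℚ) = 1 := by
  refine ⟨support_lrCoeff lam μ ▸ Finset.finite_toSet _, ?_⟩
  rw [finsum_eq_sum_of_support_subset (s := (schurBasis.repr (schur lam * schur μ)).support)]
  · have h := congrArg expSpecialization (sum_lrCoeff_smul_schur lam μ)
    simp only [map_sum, map_mul, map_intCast, expSpecialization_schur, zsmul_eq_mul] at h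
    have h1 : (hookProd lam : ℚ) ≠ 0 := Nat.cast_ne_zero.2 (hookProd_pos lam).ne'
    have h2 : (hookProd μ : ℚ) ≠ 0 := Nat.cast_ne_zero.2 (hookProd_pos μ).ne'
    calc _ = (hookProd lam : ℚ) * (hookProd μ : ℚ) *
          ∑ ν ∈ (schurBasis.repr (schur lam * schur μ)).support,
            (lrCoeff lam μ ν : ℚ) * (hookProd ν : ℚ)⁻¹ := by
          rw [Finset.mul_sum]
          exact Finset.sum_congr rfl fun ν _ => by ring
      _ = 1 := by
          rw [h]
          field_simp
  · rw [← support_lrCoeff]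
    intro ν hν h0
    exact hν (by simp [h0])
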